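/- Let $H$ be a complex Hilbert space and let $\mathcal N$ be a continuous nest on $H$, that is, a totally ordered set of orthogonal projections in $B(H)$ which contains $0$ and $I$, is closed under arbitrary suprema and infima in the lattice of all projections, and satisfies $P=\bigvee\{Q\in\mathcal N: Q<P\}$ for every $P\in\mathcal N$. Let $\mathcal T(\mathcal N)=\{T\in B(H): T(PH)\subseteq PH \text{ for all } P\in\mathcal N\}$ be its nest algebra, and let $\mathfrak L$ be a norm closed Lie ideal of $\mathcal T(\mathcal N)$, that is, a norm closed complex subspace of $\mathcal T(\mathcal N)$ with $AB-BA\in\mathfrak L$ for all $A\in\mathfrak L$ and $B\in\mathcal T(\mathcal N)$. For $x,y\in H$ let $x\otimes y$ be the operator $z\mapsto\langle z,x\rangle y$ (the inner product being linear in the first variable), and for $z\in H$ put $$P_z=\bigwedge\{Q\in\mathcal N: Qz=z\},\qquad \hat P_z=\bigvee\{Q\in\mathcal N: Qz=0\}.$$ For $P\in\mathcal N$ define $$P'=\bigvee\{P_y : x\otimes y\in\mathfrak L,\ \hat P_x<P\}\in\mathcal N,$$ and let $P'^{\perp}=I-P'$. Then a finite rank operator $T\in\mathcal T(\mathcal N)$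 lies in $\mathfrak L$ if and only if $P'^{\perp}\,T\,P=0$ for every projection $P\in\mathcal N$. -/

import Mathlib

namespace NestLie

noncomputable section

open scoped ComplexInnerProductSpace

variable {H : Type*} [NormedAddCommGroup H] [InnerProductSpace ℂ H]

/-- The operator `x ⊗ y : z ↦ ⟨z, x⟩ y`, where `⟨z, x⟩` is linear in `z`
(in Mathlib's convention this is `⟪x, z⟫`, see `tensor_apply`). -/
def tensor (x y : H) : H →L[ℂ] H := InnerProductSpace.rankOne ℂ y x

theorem tensor_apply (x y z : H) : tensor x y z = ⟪x, z⟫ • y := rfl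

/-- The nest algebra `T(N)`: the bounded operators leaving the range of each `P ∈ N` invariant. -/
def nestAlgebra (N : Set (H →L[ℂ] H)) : Subalgebra ℂ (H →L[ℂ] H) where
  carrier := {T | ∀ P ∈ N, ∀ x ∈ P.range, T x ∈ P.range}
  mul_mem' := fun ha hb P hP x hx => ha P hP _ (hb P hP x hx)
  add_mem' := fun ha hb P hP x hx => P.range.add_mem (ha P hP x hx) (hb P hP x hx)
  algebraMap_mem' := fun c P _ x hx => by
    rw [Algebra.algebraMap_eq_smul_one]
    exact P.range.smul_mem c hx

/-- A Lie ideal of `T(N)`: a complex subspace `L` of `T(N)` with `[L, T(N)] ⊆ L`. -/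
structure IsLieIdeal (N : Set (H →L[ℂ] H)) (L : Submodule ℂ (H →L[ℂ] H)) : Prop where
  subset : ∀ A ∈ L, A ∈ nestAlgebra N
  lie_mem : ∀ A ∈ L, ∀ B ∈ nestAlgebra N, A * B - B * A ∈ L

theorem isClosed_of_hasOrthogonalProjection (K : Submodule ℂ H) [K.HasOrthogonalProjection] :
    IsClosed (K : Set H) := by
  rw [← K.orthogonal_orthogonal]
  exact Kᗮ.isClosed_orthogonal

variable [CompleteSpace H]

/-- The supremum of a set of projections: the projection onto the closed linear span
of the union of their ranges. Projections carry the usual (Loewner) order of `B(H)`. -/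
def projSup (S : Set (H →L[ℂ] H)) : H →L[ℂ] H :=
  (⨆ P ∈ S, P.range).topologicalClosure.starProjection

/-- The infimum of a set of projections: the projection onto the intersection of their
ranges (an intersection that is already closed, so the closure changes nothing). -/
def projInf (S : Set (H →L[ℂ] H)) : H →L[ℂ] H :=
  (⨅ P ∈ S, P.range).topologicalClosure.starProjection

/-- `projSup S` is the least upper bound of `S` in the set of all projections. -/
theorem isLeast_projSup {S : Set (H →L[ℂ] H)} (hS : ∀ P ∈ S, IsStarProjection P) :
    IsLeast {Q : H →L[ℂ] H | IsStarProjection Q ∧ ∀ P ∈ S, P ≤ Q} (projSup S) := by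
  refine ⟨⟨isStarProjection_starProjection, fun P hP => ?_⟩, ?_⟩
  · obtain ⟨hi, he⟩ := isStarProjection_iff_eq_starProjection_range.mp (hS P hP)
    rw [he]
    exact Submodule.starProjection_le_starProjection_iff.mpr
      ((le_iSup₂ (f := fun (R : H →L[ℂ] H) (_ : R ∈ S) => R.range) P hP).trans
        (Submodule.le_topologicalClosure _))
  · rintro Q ⟨hQ, hle⟩
    obtain ⟨K, hK, rfl⟩ := isStarProjection_iff_eq_starProjection.mp hQ
    refine Submodule.starProjection_le_starProjection_iff.mpr
      (Submodule.topologicalClosure_minimal _ (iSup₂_le fun P hP => ?_)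
        (isClosed_of_hasOrthogonalProjection K))
    obtain ⟨hi, he⟩ := isStarProjection_iff_eq_starProjection_range.mp (hS P hP)
    have h := hle P hP
    rw [he] at h
    exact Submodule.starProjection_le_starProjection_iff.mp h

/-- `projInf S` is the greatest lower bound of `S` in the set of all projections. -/
theorem isGreatest_projInf {S : Set (H →L[ℂ] H)} (hS : ∀ P ∈ S, IsStarProjection P) :
    IsGreatest {Q : H →L[ℂ] H | IsStarProjection Q ∧ ∀ P ∈ S, Q ≤ P} (projInf S) := by
  refine ⟨⟨isStarProjection_starProjection, fun P hP => ?_⟩, ?_⟩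
  · obtain ⟨hi, he⟩ := isStarProjection_iff_eq_starProjection_range.mp (hS P hP)
    rw [he]
    exact Submodule.starProjection_le_starProjection_iff.mpr
      (Submodule.topologicalClosure_minimal _ (iInf₂_le P hP)
        (isClosed_of_hasOrthogonalProjection _))
  · rintro Q ⟨hQ, hle⟩
    obtain ⟨K, hK, rfl⟩ := isStarProjection_iff_eq_starProjection.mp hQ
    refine Submodule.starProjection_le_starProjection_iff.mpr
      ((le_iInf₂ fun P hP => ?_).trans (Submodule.le_topologicalClosure _))
    obtain ⟨hi, he⟩ := isStarProjection_iff_eq_starProjection_range.mp (hS P hP)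
    have h := hle P hP
    rw [he] at h
    exact Submodule.starProjection_le_starProjection_iff.mp h

/-- A complete nest: a totally ordered set of orthogonal projections containing `0` and `1`,
closed under arbitrary suprema and infima in the lattice of all projections. -/
structure IsCompleteNest (N : Set (H →L[ℂ] H)) : Prop where
  isStarProjection : ∀ P ∈ N, IsStarProjection P
  total : ∀ P ∈ N, ∀ Q ∈ N, P ≤ Q ∨ Q ≤ P
  zero_mem : (0 : H →L[ℂ] H) ∈ N
  one_mem : (1 : H →L[ℂ] H) ∈ N
  projSup_mem : ∀ S ⊆ N, projSup S ∈ N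
  projInf_mem : ∀ S ⊆ N, projInf S ∈ N

/-- `P₋ = ⋁ {Q ∈ N : Q < P}`; for `P = 0` the set is empty and this is `0`. -/
def pred (N : Set (H →L[ℂ] H)) (P : H →L[ℂ] H) : H →L[ℂ] H :=
  projSup {Q | Q ∈ N ∧ Q < P}

/-- A continuous nest: a complete nest with `P₋ = P` for all `P ∈ N`. -/
structure IsContinuousNest (N : Set (H →L[ℂ] H)) : Prop extends IsCompleteNest N where
  pred_eq : ∀ P ∈ N, pred N P = P

/-- `P_z = ⋀ {Q ∈ N : Q z = z}`. -/
def lowerProj (N : Set (H →L[ℂ] H)) (z : H) : H →L[ℂ] H :=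
  projInf {Q | Q ∈ N ∧ Q z = z}

/-- `P̂_z = ⋁ {Q ∈ N : Q z = 0}`. -/
def hatProj (N : Set (H →L[ℂ] H)) (z : H) : H →L[ℂ] H :=
  projSup {Q | Q ∈ N ∧ Q z = 0}

/-- `P' = ⋁ {P_y : x ⊗ y ∈ L, P̂_x < P}`, for a nest `N` and a subspace `L` of operators. -/
def primeProj (N : Set (H →L[ℂ] H)) (L : Submodule ℂ (H →L[ℂ] H)) (P : H →L[ℂ] H) :
    H →L[ℂ] H :=
  projSup {R | ∃ x y : H, tensor x y ∈ L ∧ hatProj N x < P ∧ R = lowerProj N y}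

end

end NestLie

/-! ### Projections and rank one operators -/

namespace NestLie

open scoped ComplexInnerProductSpace

variable {H : Type*} [NormedAddCommGroup H] [InnerProductSpace ℂ H]

/-! Although `L` is only a Lie ideal, a corner `E * A * (1 - E)` with `A ∈ L`, `E ∈ N` is a
commutator up to sign, and its product on either side with an element of the nest algebra is again
one. By continuity of the nest, each rank one operator in `L` is a corner of itself, so it can be
multiplied on both sides inside `L`. With closedness this gives `w ⊗ z ∈ L` whenever `P w = 0` and
`z ∈ P'H` (`tensor_mem_of_primeProj`).

If `T` maps every `PH` into `P'H`, subtracting such a rank one operator lowers the rank while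
keeping the condition (`mem_of_range_le_primeProj`). If `T ∈ L`, the corners of `T` map `PH` into
`P'H`, which forces `P'^⊥ T P` to commute with `N`; a finite rank operator commuting with a
continuous nest is zero (`eq_zero_of_commute`). -/

theorem mul_tensor (A : H →L[ℂ] H) (x y : H) : A * tensor x y = tensor x (A y) := by
  ext v
  simp [tensor_apply]

theorem mem_range_iff {P : H →L[ℂ] H} (hP : IsIdempotentElem P) {v : H} :
    v ∈ P.range ↔ P v = v := by
  constructor
  · rintro ⟨u, rfl⟩
    exact DFunLike.congr_fun hP.eq u
  · exact fun h => ⟨v, h⟩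

variable [CompleteSpace H]

theorem tensor_mul (A : H →L[ℂ] H) (x y : H) :
    tensor x y * A = tensor (ContinuousLinearMap.adjoint A x) y := by
  ext v
  simp [tensor_apply, ContinuousLinearMap.adjoint_inner_left]

theorem inner_projection_comm {P : H →L[ℂ] H} (hP : IsStarProjection P) (u v : H) :
    ⟪P u, v⟫ = ⟪u, P v⟫ := by
  rw [← ContinuousLinearMap.adjoint_inner_left, ← ContinuousLinearMap.star_eq_adjoint,
    hP.isSelfAdjoint.star_eq]

theorem range_le_range_iff {P Q : H →L[ℂ] H} (hP : IsStarProjection P)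
    (hQ : IsStarProjection Q) : P.range ≤ Q.range ↔ P ≤ Q := by
  obtain ⟨hi, he⟩ := isStarProjection_iff_eq_starProjection_range.mp hP
  obtain ⟨hj, hf⟩ := isStarProjection_iff_eq_starProjection_range.mp hQ
  conv_rhs => rw [he, hf]
  exact Submodule.starProjection_le_starProjection_iff.symm

theorem apply_eq_self_of_le {P Q : H →L[ℂ] H} (hP : IsStarProjection P)
    (hQ : IsStarProjection Q) (h : P ≤ Q) {v : H} (hv : P v = v) : Q v = v :=
  (mem_range_iff hQ.isIdempotentElem).1
    ((range_le_range_iff hP hQ).2 h ((mem_range_iff hP.isIdempotentElem).2 hv))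

theorem mul_eq_left_of_le {P Q : H →L[ℂ] H} (hP : IsStarProjection P)
    (hQ : IsStarProjection Q) (h : P ≤ Q) : Q * P = P := by
  ext v
  exact apply_eq_self_of_le hP hQ h (DFunLike.congr_fun hP.isIdempotentElem.eq v)

theorem mul_eq_right_of_le {P Q : H →L[ℂ] H} (hP : IsStarProjection P)
    (hQ : IsStarProjection Q) (h : P ≤ Q) : P * Q = P := by
  have := congrArg star (mul_eq_left_of_le hP hQ h)
  rwa [star_mul, hP.isSelfAdjoint.star_eq, hQ.isSelfAdjoint.star_eq] at this

theorem range_projSup (S : Set (H →L[ℂ] H)) :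
    (projSup S).range = (⨆ P ∈ S, P.range).topologicalClosure := by
  simp [projSup]

theorem range_projSup_le {S : Set (H →L[ℂ] H)} {K : Submodule ℂ H}
    (hK : IsClosed (K : Set H)) (h : ∀ P ∈ S, P.range ≤ K) : (projSup S).range ≤ K := by
  rw [range_projSup]
  exact Submodule.topologicalClosure_minimal _ (iSup₂_le h) hK

theorem apply_projInf {S : Set (H →L[ℂ] H)} (hS : ∀ P ∈ S, IsStarProjection P) {v : H}
    (h : ∀ P ∈ S, P v = v) : projInf S v = v := by
  rw [projInf, Submodule.starProjection_eq_self_iff]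
  refine Submodule.le_topologicalClosure _ ?_
  simp only [Submodule.mem_iInf]
  exact fun P hP => (mem_range_iff (hS P hP).isIdempotentElem).2 (h P hP)

/-! ### Complete nests -/

namespace IsCompleteNest

variable {N : Set (H →L[ℂ] H)}

theorem lt_of_not_le (hN : IsCompleteNest N) {P Q : H →L[ℂ] H} (hP : P ∈ N) (hQ : Q ∈ N)
    (h : ¬ P ≤ Q) : Q < P :=
  lt_of_le_not_ge ((hN.total P hP Q hQ).resolve_left h) h

theorem mul_comm (hN : IsCompleteNest N) {P Q : H →L[ℂ] H} (hP : P ∈ N) (hQ : Q ∈ N) :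
    P * Q = Q * P := by
  have hP' := hN.isStarProjection P hP
  have hQ' := hN.isStarProjection Q hQ
  rcases hN.total P hP Q hQ with h | h
  · rw [mul_eq_left_of_le hP' hQ' h, mul_eq_right_of_le hP' hQ' h]
  · rw [mul_eq_left_of_le hQ' hP' h, mul_eq_right_of_le hQ' hP' h]

theorem projection_mem_nestAlgebra (hN : IsCompleteNest N) {P : H →L[ℂ] H} (hP : P ∈ N) :
    P ∈ nestAlgebra N := by
  intro Q hQ x hx
  have hQ' := (hN.isStarProjection Q hQ).isIdempotentElem
  rw [mem_range_iff hQ'] at hx ⊢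
  have h := DFunLike.congr_fun (hN.mul_comm hQ hP) x
  simpa [hx] using h

theorem tensor_mem_nestAlgebra (hN : IsCompleteNest N) {P : H →L[ℂ] H} (hP : P ∈ N) {x y : H}
    (hx : P x = 0) (hy : P y = y) : tensor x y ∈ nestAlgebra N := by
  intro Q hQ v hv
  have hQ' := hN.isStarProjection Q hQ
  have hP' := hN.isStarProjection P hP
  rcases hN.total P hP Q hQ with h | h
  · rw [tensor_apply]
    exact Q.range.smul_mem _
      ((mem_range_iff hQ'.isIdempotentElem).2 (apply_eq_self_of_le hP' hQ' h hy))
  · rw [mem_range_iff hQ'.isIdempotentElem] at hv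
    have hv' := apply_eq_self_of_le hQ' hP' h hv
    rw [tensor_apply, ← hv', ← inner_projection_comm hP', hx]
    simp

theorem mul_mul_self_of_mem_nestAlgebra (hN : IsCompleteNest N) {P A : H →L[ℂ] H} (hP : P ∈ N)
    (hA : A ∈ nestAlgebra N) : P * A * P = A * P := by
  ext v
  exact (mem_range_iff (hN.isStarProjection P hP).isIdempotentElem).1
    (hA P hP (P v) ⟨v, rfl⟩)

theorem hatProj_mem (hN : IsCompleteNest N) (z : H) : hatProj N z ∈ N :=
  hN.projSup_mem _ fun _ h => h.1

theorem lowerProj_mem (hN : IsCompleteNest N) (z : H) : lowerProj N z ∈ N :=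
  hN.projInf_mem _ fun _ h => h.1

theorem primeProj_mem (hN : IsCompleteNest N) (L : Submodule ℂ (H →L[ℂ] H)) (P : H →L[ℂ] H) :
    primeProj N L P ∈ N := by
  refine hN.projSup_mem _ ?_
  rintro _ ⟨_, y, -, -, rfl⟩
  exact hN.lowerProj_mem y

theorem lowerProj_apply (hN : IsCompleteNest N) (z : H) : lowerProj N z z = z :=
  apply_projInf (fun P hP => hN.isStarProjection P hP.1) fun _ hP => hP.2

theorem mul_projSup_eq_zero (A : H →L[ℂ] H) {S : Set (H →L[ℂ] H)} (h : ∀ P ∈ S, A * P = 0) :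
    A * projSup S = 0 := by
  have : (projSup S).range ≤ A.ker := by
    refine range_projSup_le (ContinuousLinearMap.isClosed_ker A) fun P hP => ?_
    rintro _ ⟨v, rfl⟩
    exact DFunLike.congr_fun (h P hP) v
  ext v
  exact this ⟨v, rfl⟩

theorem hatProj_apply (hN : IsCompleteNest N) (z : H) : hatProj N z z = 0 := by
  have h := hN.isStarProjection _ (hN.hatProj_mem z)
  have hle : (hatProj N z).range ≤ (ℂ ∙ z)ᗮ := by
    refine range_projSup_le (Submodule.isClosed_orthogonal _) ?_
    rintro P ⟨hP, hPz⟩ _ ⟨v, rfl⟩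
    rw [Submodule.mem_orthogonal_singleton_iff_inner_right, ContinuousLinearMap.coe_coe,
      ← inner_projection_comm (hN.isStarProjection P hP), hPz, inner_zero_left]
  have h1 := Submodule.mem_orthogonal_singleton_iff_inner_right.1 (hle ⟨z, rfl⟩)
  rw [ContinuousLinearMap.coe_coe] at h1
  rw [← inner_self_eq_zero (𝕜 := ℂ), inner_projection_comm h,
    show hatProj N z (hatProj N z z) = hatProj N z z from
      DFunLike.congr_fun h.isIdempotentElem.eq z, h1]

theorem le_hatProj (hN : IsCompleteNest N) {P : H →L[ℂ] H} (hP : P ∈ N) {z : H}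
    (h : P z = 0) : P ≤ hatProj N z :=
  (isLeast_projSup fun Q hQ => hN.isStarProjection Q hQ.1).1.2 P ⟨hP, h⟩

theorem lowerProj_le (hN : IsCompleteNest N) {P : H →L[ℂ] H} (hP : P ∈ N) {z : H}
    (h : P z = z) : lowerProj N z ≤ P :=
  (isGreatest_projInf fun Q hQ => hN.isStarProjection Q hQ.1).1.2 P ⟨hP, h⟩

/-- A nonzero finite rank operator vanishes on a largest element `P` of the nest, and the images
of the larger elements have a common nonzero vector. -/
theorem exists_common_image (hN : IsCompleteNest N) {T : H →L[ℂ] H}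
    (hfin : FiniteDimensional ℂ T.range) (hT : T ≠ 0) :
    ∃ P ∈ N, T * P = 0 ∧ ∃ z : H, z ≠ 0 ∧ ∀ Q ∈ N, P < Q → ∃ u : H, T (Q u) = z := by
  classical
  set P := projSup {Q | Q ∈ N ∧ T * Q = 0}
  have hP : P ∈ N := hN.projSup_mem _ fun _ h => h.1
  have hTP : T * P = 0 := mul_projSup_eq_zero T fun _ h => h.2
  have hP1 : P < 1 := by
    refine hN.lt_of_not_le hN.one_mem hP fun h => hT ?_
    have := mul_eq_left_of_le (hN.isStarProjection _ hN.one_mem) (hN.isStarProjection P hP) h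
    rw [mul_one] at this
    rw [← hTP, this, mul_one]
  -- Choose `R > P` minimizing the rank of `T * R`; for `P < Q ≤ R` the nested ranges have equal
  -- dimension, so they coincide.
  let f : (H →L[ℂ] H) → ℕ := fun Q => Module.finrank ℂ (T * Q).range
  obtain ⟨R, ⟨hR, hPR⟩, hmin⟩ := WellFounded.has_min (measure f).wf {Q | Q ∈ N ∧ P < Q}
    ⟨1, hN.one_mem, hP1⟩
  have hne : T * R ≠ 0 := fun h =>
    not_le_of_gt hPR ((isLeast_projSup fun Q hQ => hN.isStarProjection Q hQ.1).1.2 R ⟨hR, h⟩)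
  obtain ⟨v, hv⟩ : ∃ v, (T * R) v ≠ 0 := by
    by_contra! h
    exact hne (ContinuousLinearMap.ext h)
  refine ⟨P, hP, hTP, (T * R) v, hv, fun Q hQ hPQ => ?_⟩
  rcases hN.total Q hQ R hR with h | h
  · have hle : (T * Q).range ≤ (T * R).range := by
      rintro _ ⟨u, rfl⟩
      refine ⟨Q u, ?_⟩
      have := DFunLike.congr_fun
        (mul_eq_left_of_le (hN.isStarProjection Q hQ) (hN.isStarProjection R hR) h) u
      exact congrArg T this
    have hle' : (T * R).range ≤ T.range := by
      rintro _ ⟨u, rfl⟩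
      exact ⟨R u, rfl⟩
    have : FiniteDimensional ℂ (T * R).range := Submodule.finiteDimensional_of_le hle'
    have heq := Submodule.eq_of_le_of_finrank_le hle (not_lt.1 (hmin Q ⟨hQ, hPQ⟩))
    have hmem : (T * R) v ∈ (T * Q).range := heq ▸ ⟨v, rfl⟩
    exact hmem
  · refine ⟨R v, congrArg T ?_⟩
    exact DFunLike.congr_fun
      (mul_eq_left_of_le (hN.isStarProjection R hR) (hN.isStarProjection Q hQ) h) v

end IsCompleteNest

/-! ### Consequences of continuity -/

namespace IsContinuousNest

variable {N : Set (H →L[ℂ] H)}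

/-- There is no gap above `P`: if the infimum `R` of the larger elements exceeded `P`, every `Q < R`
would lie below `P`, giving `R = R₋ ≤ P`. -/
theorem apply_eq_self_of_forall_gt (hN : IsContinuousNest N) {P : H →L[ℂ] H} (hP : P ∈ N) {z : H}
    (h : ∀ Q ∈ N, P < Q → Q z = z) : P z = z := by
  set R := projInf {Q | Q ∈ N ∧ P < Q}
  have hs : ∀ Q ∈ {Q | Q ∈ N ∧ P < Q}, IsStarProjection Q :=
    fun Q hQ => hN.isStarProjection Q hQ.1
  have hR : R ∈ N := hN.projInf_mem _ fun _ h => h.1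
  have hRz : R z = z := apply_projInf hs fun Q hQ => h Q hQ.1 hQ.2
  have hRP : R ≤ P := by
    by_contra hlt
    have hlt := hN.lt_of_not_le hR hP hlt
    refine not_le_of_gt hlt ?_
    rw [← hN.pred_eq R hR]
    refine (isLeast_projSup fun Q hQ => hN.isStarProjection Q hQ.1).2
      ⟨hN.isStarProjection P hP, fun Q hQ => ?_⟩
    by_contra hQP
    exact not_le_of_gt hQ.2
      ((isGreatest_projInf hs).1.2 Q ⟨hQ.1, hN.lt_of_not_le hQ.1 hP hQP⟩)
  exact apply_eq_self_of_le (hN.isStarProjection R hR) (hN.isStarProjection P hP) hRP hRz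

theorem range_le_of_forall_lt (hN : IsContinuousNest N) {P : H →L[ℂ] H} (hP : P ∈ N)
    {K : Submodule ℂ H} (hK : IsClosed (K : Set H)) (h : ∀ Q ∈ N, Q < P → Q.range ≤ K) :
    P.range ≤ K := by
  rw [← hN.pred_eq P hP]
  exact range_projSup_le hK fun Q hQ => h Q hQ.1 hQ.2

/-- Commutation puts the common image vector `z` in every `QH` with `Q > P`, hence in `PH`; but `P S
= S P = 0`, so `P` kills `z`. -/
theorem eq_zero_of_commute (hN : IsContinuousNest N) {S : H →L[ℂ] H}
    (hfin : FiniteDimensional ℂ S.range) (h : ∀ P ∈ N, P * S = S * P) : S = 0 := by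
  by_contra hS
  obtain ⟨P, hP, hSP, z, hz, hu⟩ := hN.exists_common_image hfin hS
  have hPS (u : H) : P (S u) = 0 := by
    have := DFunLike.congr_fun ((h P hP).trans hSP) u
    exact this
  have hPz : P z = z := by
    refine hN.apply_eq_self_of_forall_gt hP fun Q hQ hPQ => ?_
    obtain ⟨u, rfl⟩ := hu Q hQ hPQ
    have h1 := DFunLike.congr_fun (h Q hQ) (Q u)
    have h2 : Q (Q u) = Q u :=
      DFunLike.congr_fun (hN.isStarProjection Q hQ).isIdempotentElem.eq u
    simpa [h2] using h1
  obtain ⟨u, hu⟩ : ∃ u, S u = z := by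
    by_cases hP1 : P < 1
    · obtain ⟨u, hu⟩ := hu 1 hN.one_mem hP1
      exact ⟨_, hu⟩
    · refine (hS ?_).elim
      have hle : (1 : H →L[ℂ] H) ≤ P := by
        by_contra hle
        exact hP1 (hN.lt_of_not_le hN.one_mem hP hle)
      have := mul_eq_left_of_le (hN.isStarProjection _ hN.one_mem) (hN.isStarProjection P hP) hle
      rw [mul_one] at this
      rwa [this, mul_one] at hSP
  exact hz (by rw [← hPz, ← hu, hPS])

end IsContinuousNest

/-! ### Corners and rank one operators of a Lie ideal -/

section LieIdeal

variable {N : Set (H →L[ℂ] H)} {L : Submodule ℂ (H →L[ℂ] H)}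

theorem IsLieIdeal.corner_mem (hL : IsLieIdeal N L) (hN : IsCompleteNest N) {A E : H →L[ℂ] H}
    (hA : A ∈ L) (hE : E ∈ N) : E * A * (1 - E) ∈ L := by
  have h := L.neg_mem (hL.lie_mem A hA E (hN.projection_mem_nestAlgebra hE))
  rw [← hN.mul_mul_self_of_mem_nestAlgebra hE (hL.subset A hA)] at h
  convert h using 1
  noncomm_ring

/-- Commute the corner with `(1 - E) * C`: the reversed product vanishes since `(1 - E) * C * E =
0`. -/
theorem IsLieIdeal.corner_mul_mem (hL : IsLieIdeal N L) (hN : IsCompleteNest N)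
    {A E C : H →L[ℂ] H} (hA : A ∈ L) (hE : E ∈ N) (hC : C ∈ nestAlgebra N) :
    E * A * (1 - E) * C ∈ L := by
  have hEC : (1 - E) * C ∈ nestAlgebra N :=
    mul_mem (sub_mem (one_mem _) (hN.projection_mem_nestAlgebra hE)) hC
  have h := hL.lie_mem _ (hL.corner_mem hN hA hE) _ hEC
  have hi : (1 - E) * (1 - E) = 1 - E := (hN.isStarProjection E hE).isIdempotentElem.one_sub.eq
  have hz : (1 - E) * C * E = 0 := by
    rw [sub_mul, sub_mul, one_mul, hN.mul_mul_self_of_mem_nestAlgebra hE hC, sub_self]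
  have h1 : E * A * (1 - E) * ((1 - E) * C) = E * A * (1 - E) * C := by
    rw [← mul_assoc, mul_assoc (E * A), hi]
  have h2 : (1 - E) * C * (E * A * (1 - E)) = 0 := by
    rw [mul_assoc E, ← mul_assoc, hz, zero_mul]
  rwa [h1, h2, sub_zero] at h

theorem IsLieIdeal.mul_corner_mem (hL : IsLieIdeal N L) (hN : IsCompleteNest N)
    {A E C : H →L[ℂ] H} (hA : A ∈ L) (hE : E ∈ N) (hC : C ∈ nestAlgebra N) :
    C * (E * A * (1 - E)) ∈ L := by
  have hCE : C * E ∈ nestAlgebra N := mul_mem hC (hN.projection_mem_nestAlgebra hE)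
  have h := L.neg_mem (hL.lie_mem _ (hL.corner_mem hN hA hE) _ hCE)
  have hi : E * E = E := (hN.isStarProjection E hE).isIdempotentElem.eq
  have hz : (1 - E) * C * E = 0 := by
    rw [sub_mul, sub_mul, one_mul, hN.mul_mul_self_of_mem_nestAlgebra hE hC, sub_self]
  have h1 : E * A * (1 - E) * (C * E) = 0 := by
    rw [mul_assoc (E * A), ← mul_assoc (1 - E), hz, mul_zero]
  have h2 : C * E * (E * A * (1 - E)) = C * (E * A * (1 - E)) := by
    simp only [← mul_assoc]
    rw [mul_assoc C, hi]
  rwa [h1, h2, zero_sub, neg_neg] at h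

theorem corner_tensor {E : H →L[ℂ] H} (hE : IsStarProjection E) {x y : H} (hx : E x = 0)
    (hy : E y = y) : E * tensor x y * (1 - E) = tensor x y := by
  ext v
  simp [tensor_apply, ← inner_projection_comm hE, hx, hy]

/-- For `Q > P̂_x`, `x ⊗ y` sends `Q x` to `‖Q x‖² y` with `Q x ≠ 0`, so `y ∈ QH`; then let `Q`
descend to `P̂_x`. -/
theorem IsLieIdeal.hatProj_apply_of_tensor_mem (hL : IsLieIdeal N L) (hN : IsContinuousNest N)
    {x y : H} (h : tensor x y ∈ L) : hatProj N x y = y := by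
  refine hN.apply_eq_self_of_forall_gt (hN.hatProj_mem x) fun Q hQ hlt => ?_
  have hQ' := hN.isStarProjection Q hQ
  have hQx : Q x ≠ 0 := fun h0 => not_le_of_gt hlt (hN.le_hatProj hQ h0)
  have h1 := hL.subset _ h Q hQ (Q x) ⟨x, rfl⟩
  have h2 : ⟪x, Q x⟫ ≠ 0 := by
    rw [← show Q (Q x) = Q x from DFunLike.congr_fun hQ'.isIdempotentElem.eq x,
      ← inner_projection_comm hQ']
    exact inner_self_ne_zero.2 hQx
  rw [tensor_apply, Submodule.smul_mem_iff _ h2] at h1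
  exact (mem_range_iff hQ'.isIdempotentElem).1 h1

/-- The vectors `z` with `w ⊗ z ∈ L`. -/
def leftSlice (L : Submodule ℂ (H →L[ℂ] H)) (w : H) : Submodule ℂ H where
  carrier := {z | tensor w z ∈ L}
  add_mem' := fun {a b} ha hb => by
    have h : tensor w (a + b) = tensor w a + tensor w b := by ext; simp [tensor_apply]
    rw [Set.mem_ofPred_eq, h]
    exact L.add_mem ha hb
  zero_mem' := by
    have h : tensor w (0 : H) = 0 := by ext; simp [tensor_apply]
    rw [Set.mem_ofPred_eq, h]
    exact L.zero_mem
  smul_mem' := fun c a ha => by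
    have h : tensor w (c • a) = c • tensor w a := by
      ext; simp [tensor_apply, smul_smul, _root_.mul_comm]
    rw [Set.mem_ofPred_eq, h]
    exact L.smul_mem c ha

/-- The vectors `w` with `w ⊗ z ∈ L`. -/
def rightSlice (L : Submodule ℂ (H →L[ℂ] H)) (z : H) : Submodule ℂ H where
  carrier := {w | tensor w z ∈ L}
  add_mem' := fun {a b} ha hb => by
    have h : tensor (a + b) z = tensor a z + tensor b z := by
      ext; simp [tensor_apply, add_smul]
    rw [Set.mem_ofPred_eq, h]
    exact L.add_mem ha hb
  zero_mem' := by
    have h : tensor (0 : H) z = 0 := by ext; simp [tensor_apply]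
    rw [Set.mem_ofPred_eq, h]
    exact L.zero_mem
  smul_mem' := fun c a ha => by
    have h : tensor (c • a) z = (starRingEnd ℂ c) • tensor a z := by
      ext; simp [tensor_apply, smul_smul, _root_.mul_comm]
    rw [Set.mem_ofPred_eq, h]
    exact L.smul_mem _ ha

theorem isClosed_leftSlice (hLc : IsClosed (L : Set (H →L[ℂ] H))) (w : H) :
    IsClosed (leftSlice L w : Set H) := by
  refine hLc.preimage (f := fun z => tensor w z) ?_
  unfold tensor
  fun_prop

theorem isClosed_rightSlice (hLc : IsClosed (L : Set (H →L[ℂ] H))) (z : H) :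
    IsClosed (rightSlice L z : Set H) := by
  refine hLc.preimage (f := fun w => tensor w z) ?_
  unfold tensor
  fun_prop

/-- Right multiplication by `w ⊗ P x` replaces `x` by `w`; left multiplication by `(y - Q y) ⊗ v`,
with `Q < P_y` and `v ∈ QH`, replaces `y` by `v`, up to nonzero scalars. Such `v` span a dense
subspace of the range of `P_y`. -/
theorem IsLieIdeal.tensor_mem_of_lowerProj (hL : IsLieIdeal N L) (hN : IsContinuousNest N)
    (hLc : IsClosed (L : Set (H →L[ℂ] H))) {x y w z : H} {P : H →L[ℂ] H} (hP : P ∈ N)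
    (hxy : tensor x y ∈ L) (hlt : hatProj N x < P) (hw : P w = 0)
    (hz : z ∈ (lowerProj N y).range) : tensor w z ∈ L := by
  have hE := hN.hatProj_mem x
  have hE' := hN.isStarProjection _ hE
  have hP' := hN.isStarProjection P hP
  have hidem : P (P x) = P x := DFunLike.congr_fun hP'.isIdempotentElem.eq x
  have hEy := hL.hatProj_apply_of_tensor_mem hN hxy
  have hPy : P y = y := apply_eq_self_of_le hE' hP' hlt.le hEy
  have hPx : P x ≠ 0 := fun h0 => not_le_of_gt hlt (hN.le_hatProj hP h0)
  have hwy : tensor w y ∈ L := by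
    have h := hL.corner_mul_mem hN.toIsCompleteNest hxy hE
      (hN.tensor_mem_nestAlgebra hP hw hidem)
    rw [corner_tensor hE' (hN.hatProj_apply x) hEy, mul_tensor, tensor_apply, ← hidem,
      ← inner_projection_comm hP'] at h
    exact ((leftSlice L w).smul_mem_iff (inner_self_ne_zero.2 hPx)).1 h
  refine hN.range_le_of_forall_lt (K := leftSlice L w) (hN.lowerProj_mem y)
    (isClosed_leftSlice hLc w) (fun Q hQ hQy v hv => ?_) hz
  have hQ' := hN.isStarProjection Q hQ
  have hQi : Q (Q y) = Q y := DFunLike.congr_fun hQ'.isIdempotentElem.eq y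
  have hne : y - Q y ≠ 0 := fun h0 =>
    not_le_of_gt hQy (hN.lowerProj_le hQ (sub_eq_zero.1 h0).symm)
  have hD := hN.tensor_mem_nestAlgebra hQ (x := y - Q y) (y := v) (by rw [map_sub, hQi, sub_self])
    ((mem_range_iff hQ'.isIdempotentElem).1 hv)
  have h := hL.mul_corner_mem hN.toIsCompleteNest hwy hP hD
  rw [corner_tensor hP' hw hPy, mul_tensor, tensor_apply] at h
  have hin : ⟪y - Q y, y⟫ = ⟪y - Q y, y - Q y⟫ := by
    have : ⟪y - Q y, Q y⟫ = 0 := by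
      rw [← inner_projection_comm hQ', map_sub, hQi, sub_self, inner_zero_left]
    rw [inner_sub_right, this, sub_zero]
  rw [hin] at h
  exact ((leftSlice L w).smul_mem_iff (inner_self_ne_zero.2 hne)).1 h

theorem IsLieIdeal.tensor_mem_of_primeProj (hL : IsLieIdeal N L) (hN : IsContinuousNest N)
    (hLc : IsClosed (L : Set (H →L[ℂ] H))) {w z : H} {P : H →L[ℂ] H} (hP : P ∈ N)
    (hw : P w = 0) (hz : z ∈ (primeProj N L P).range) : tensor w z ∈ L := by
  refine range_projSup_le (K := leftSlice L w) (isClosed_leftSlice hLc w) ?_ hz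
  rintro _ ⟨x, y, hxy, hlt, rfl⟩ v hv
  exact hL.tensor_mem_of_lowerProj hN hLc hP hxy hlt hw hv

/-- The limit `Q ↓ P` is taken by duality: a vector orthogonal to the slice is fixed by every `Q >
P`, hence by `P`, hence is orthogonal to `w`. -/
theorem IsLieIdeal.tensor_mem_of_forall_gt (hL : IsLieIdeal N L) (hN : IsContinuousNest N)
    (hLc : IsClosed (L : Set (H →L[ℂ] H))) {w z : H} {P : H →L[ℂ] H} (hP : P ∈ N)
    (hw : P w = 0) (hz : ∀ Q ∈ N, P < Q → z ∈ (primeProj N L Q).range) : tensor w z ∈ L := by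
  have hP' := hN.isStarProjection P hP
  have := (isClosed_rightSlice hLc z).completeSpace_coe
  suffices h : w ∈ (rightSlice L z)ᗮᗮ by
    rwa [Submodule.orthogonal_orthogonal] at h
  rw [Submodule.mem_orthogonal]
  intro v hv
  have hPv : P v = v := by
    refine hN.apply_eq_self_of_forall_gt hP fun Q hQ hPQ => ?_
    have hQ' := hN.isStarProjection Q hQ
    have hQv : Q (Q v) = Q v := DFunLike.congr_fun hQ'.isIdempotentElem.eq v
    have h0 : Q (v - Q v) = 0 := by rw [map_sub, hQv, sub_self]
    have h1 : v - Q v ∈ rightSlice L z :=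
      hL.tensor_mem_of_primeProj hN hLc hQ h0 (hz Q hQ hPQ)
    have h2 := (Submodule.mem_orthogonal _ _).1 hv _ h1
    have h3 : ⟪v - Q v, Q v⟫ = 0 := by
      rw [← inner_projection_comm hQ', h0, inner_zero_left]
    have h4 : ⟪v - Q v, v - Q v⟫ = 0 := by rw [inner_sub_right, h2, h3, sub_zero]
    exact (sub_eq_zero.1 (inner_self_eq_zero.1 h4)).symm
  rw [← hPv, inner_projection_comm hP', hw, inner_zero_right]

theorem IsLieIdeal.mem_of_range_le_primeProj (hL : IsLieIdeal N L) (hN : IsContinuousNest N)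
    (hLc : IsClosed (L : Set (H →L[ℂ] H))) (n : ℕ) :
    ∀ T : H →L[ℂ] H, FiniteDimensional ℂ T.range → Module.finrank ℂ T.range = n →
      (∀ P ∈ N, ∀ v, T (P v) ∈ (primeProj N L P).range) → T ∈ L := by
  induction n using Nat.strong_induction_on with
  | _ n ih =>
    intro T hfin hn hT
    by_cases hT0 : T = 0
    · exact hT0 ▸ L.zero_mem
    obtain ⟨P, hP, hTP, z, hz, hu⟩ := hN.exists_common_image hfin hT0
    have hzr (Q : H →L[ℂ] H) (hQ : Q ∈ N) (hPQ : P < Q) : z ∈ (primeProj N L Q).range := by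
      obtain ⟨u, rfl⟩ := hu Q hQ hPQ
      exact hT Q hQ u
    have hzT : z ∈ T.range := by
      by_cases hP1 : P < 1
      · obtain ⟨u, hu⟩ := hu 1 hN.one_mem hP1
        exact ⟨_, hu⟩
      · refine (hT0 ?_).elim
        have hle : (1 : H →L[ℂ] H) ≤ P := by
          by_contra hle
          exact hP1 (hN.lt_of_not_le hN.one_mem hP hle)
        have := mul_eq_left_of_le (hN.isStarProjection _ hN.one_mem) (hN.isStarProjection P hP) hle
        rw [mul_one] at this
        rwa [this, mul_one] at hTP
    -- `F = T* z ⊗ z`, and `T - c • F` is `T` followed by the projection onto the complement of `z`.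
    set F : H →L[ℂ] H := tensor z z * T with hF
    have hFa (v : H) : F v = ⟪z, T v⟫ • z := rfl
    set c : ℂ := ⟪z, z⟫⁻¹ with hc
    have hzz : ⟪z, z⟫ ≠ 0 := inner_self_ne_zero.2 hz
    have hFP (v : H) : T (P v) = 0 := DFunLike.congr_fun hTP v
    have hFL : F ∈ L := by
      rw [hF, tensor_mul]
      refine hL.tensor_mem_of_forall_gt hN hLc hP ?_ hzr
      rw [← inner_self_eq_zero (𝕜 := ℂ), inner_projection_comm (hN.isStarProjection P hP),
        ContinuousLinearMap.adjoint_inner_left, hFP, inner_zero_right]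
    have hrange : (T - c • F).range ≤ T.range := by
      rintro _ ⟨v, rfl⟩
      exact T.range.sub_mem ⟨v, rfl⟩ (T.range.smul_mem _ (T.range.smul_mem _ hzT))
    have hperp (v : H) : ⟪z, (T - c • F) v⟫ = 0 := by
      simp only [sub_apply, smul_apply, hFa,
        inner_sub_right, inner_smul_right, hc]
      field_simp
      ring
    have hlt : (T - c • F).range < T.range := by
      refine lt_of_le_of_ne hrange fun heq => hzz ?_
      rw [← heq] at hzT
      obtain ⟨v, hv⟩ := hzT
      have := hperp v
      rwa [show (T - c • F) v = z from hv] at this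
    have hmem : T - c • F ∈ L := by
      refine ih _ (hn ▸ Submodule.finrank_lt_finrank_of_lt hlt) _
        (Submodule.finiteDimensional_of_le hrange) rfl fun Q hQ v => ?_
      refine Submodule.sub_mem _ (hT Q hQ v) (Submodule.smul_mem _ _ ?_)
      rw [ContinuousLinearMap.coe_coe, hFa]
      by_cases hQP : Q ≤ P
      · have : P (Q v) = Q v := DFunLike.congr_fun
          (mul_eq_left_of_le (hN.isStarProjection Q hQ) (hN.isStarProjection P hP) hQP) v
        rw [← this, hFP, inner_zero_right, zero_smul]
        exact Submodule.zero_mem _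
      · exact Submodule.smul_mem _ _ (hzr Q hQ (hN.lt_of_not_le hQ hP hQP))
    have := L.add_mem hmem (L.smul_mem c hFL)
    rwa [sub_add_cancel] at this

theorem IsLieIdeal.corner_apply_mem_primeProj (hL : IsLieIdeal N L) (hN : IsContinuousNest N)
    {T E P : H →L[ℂ] H} (hT : T ∈ L) (hE : E ∈ N) (hP : P ∈ N) (v : H) :
    (E * T * (1 - E)) (P v) ∈ (primeProj N L P).range := by
  set A := E * T * (1 - E)
  have hR := hN.isStarProjection _ (hN.primeProj_mem L P)
  have hclosed : IsClosed ((primeProj N L P).range.comap A.toLinearMap : Set H) := by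
    have h : IsClosed ((primeProj N L P).range : Set H) := by
      rw [primeProj, range_projSup]
      exact Submodule.isClosed_topologicalClosure _
    exact h.preimage A.continuous
  refine hN.range_le_of_forall_lt hP hclosed (fun Q hQ hQP u hu => ?_) ⟨v, rfl⟩
  have hQ' := hN.isStarProjection Q hQ
  have hP' := hN.isStarProjection P hP
  rw [mem_range_iff hQ'.isIdempotentElem] at hu
  -- The vector `w - Q w` is nonzero, killed by `Q` and fixed by `P`; hence `(w - Q w) ⊗ u` is in
  -- the nest algebra and its `hatProj` is below `P`.
  obtain ⟨w, hw, hQw⟩ : ∃ w, P w = w ∧ Q w ≠ w := by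
    by_contra! h
    refine not_le_of_gt hQP ((range_le_range_iff hP' hQ').1 fun w hw => ?_)
    exact (mem_range_iff hQ'.isIdempotentElem).2
      (h w ((mem_range_iff hP'.isIdempotentElem).1 hw))
  have hQi : Q (Q w) = Q w := DFunLike.congr_fun hQ'.isIdempotentElem.eq w
  have hPx : P (w - Q w) = w - Q w := by
    rw [map_sub, hw, apply_eq_self_of_le hQ' hP' hQP.le hQi]
  have hmem := hL.corner_mul_mem hN.toIsCompleteNest hT hE
    (hN.tensor_mem_nestAlgebra hQ (x := w - Q w) (by rw [map_sub, hQi, sub_self]) hu)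
  rw [mul_tensor] at hmem
  have hlt : hatProj N (w - Q w) < P := by
    refine hN.lt_of_not_le hP (hN.hatProj_mem _) fun hle => hQw ?_
    have h := apply_eq_self_of_le hP' (hN.isStarProjection _ (hN.hatProj_mem _)) hle hPx
    rw [hN.hatProj_apply] at h
    exact (sub_eq_zero.1 h.symm).symm
  have hle : lowerProj N (A u) ≤ primeProj N L P :=
    (isLeast_projSup (by
      rintro _ ⟨x, y, -, -, rfl⟩
      exact hN.isStarProjection _ (hN.lowerProj_mem y))).1.2 _ ⟨_, _, hmem, hlt, rfl⟩
  exact (mem_range_iff hR.isIdempotentElem).2 (apply_eq_self_of_le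
    (hN.isStarProjection _ (hN.lowerProj_mem _)) hR hle (hN.lowerProj_apply _))

theorem IsLieIdeal.compression_eq_zero (hL : IsLieIdeal N L) (hN : IsContinuousNest N)
    {T P : H →L[ℂ] H} (hT : T ∈ L) (hfin : FiniteDimensional ℂ T.range) (hP : P ∈ N) :
    (1 - primeProj N L P) * T * P = 0 := by
  set R := primeProj N L P with hRdef
  have hR : R ∈ N := hN.primeProj_mem L P
  have hTN := hL.subset T hT
  refine hN.eq_zero_of_commute ?_ fun E hE => ?_
  · have hle : ((1 - R) * T * P).range ≤ T.range.map (1 - R).toLinearMap := by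
      rintro _ ⟨v, rfl⟩
      exact ⟨T (P v), ⟨P v, rfl⟩, rfl⟩
    exact Submodule.finiteDimensional_of_le hle
  · have hER : E * (1 - R) = (1 - R) * E := by
      rw [mul_sub, sub_mul, hN.mul_comm hE hR, one_mul, mul_one]
    have hEP := hN.mul_comm hE hP
    -- This lets `E * T` be replaced by `E * T * E = T * E` between `1 - R` and `P`.
    have h0 : (1 - R) * (E * T * (1 - E)) * P = 0 := by
      ext v
      have := hL.corner_apply_mem_primeProj hN hT hE hP v
      rw [mem_range_iff (hN.isStarProjection R hR).isIdempotentElem] at this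
      exact sub_eq_zero.2 this.symm
    have hETE := hN.mul_mul_self_of_mem_nestAlgebra hE hTN
    calc E * ((1 - R) * T * P) = (1 - R) * (E * T) * P := by
          rw [← mul_assoc, ← mul_assoc, hER, mul_assoc (1 - R)]
      _ = (1 - R) * (E * T * (1 - E)) * P + (1 - R) * (E * T * E) * P := by noncomm_ring
      _ = (1 - R) * T * P * E := by
          rw [h0, zero_add, hETE, mul_assoc _ P, ← hEP]
          simp only [mul_assoc]

end LieIdeal

end NestLie

theorem theorem4p3 {H : Type*} [NormedAddCommGroup H] [InnerProductSpace ℂ H] [CompleteSpace H]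
    (N : Set (H →L[ℂ] H)) (hN : NestLie.IsContinuousNest N)
    (L : Submodule ℂ (H →L[ℂ] H)) (hL : NestLie.IsLieIdeal N L)
    (hLc : IsClosed (L : Set (H →L[ℂ] H)))
    (T : H →L[ℂ] H) (hT : T ∈ NestLie.nestAlgebra N) (hfin : FiniteDimensional ℂ T.range) :
    T ∈ L ↔ ∀ P ∈ N, (1 - NestLie.primeProj N L P) * T * P = 0 := by
  refine ⟨fun h P hP => hL.compression_eq_zero hN h hfin hP, fun h => ?_⟩
  refine hL.mem_of_range_le_primeProj hN hLc _ T hfin rfl fun P hP v => ?_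
  rw [NestLie.mem_range_iff
    (hN.isStarProjection _ (hN.primeProj_mem L P)).isIdempotentElem]
  exact (sub_eq_zero.1 (DFunLike.congr_fun (h P hP) v)).symm
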